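/- Let $A$ be a $C^*$-algebra (unital or not) with enveloping von Neumann algebra $A^{**}$, into which $A$ is canonically embedded. For a set $R$ of self-adjoint elements of $A^{**}$ let $R^m$ be the set of ($\sigma$-weak) limits of bounded increasing nets from $R$, and let $R_{\mathbb C}=R+iR$. Write $A_{sa}$ for the self-adjoint part of $A$ and ${}^-$ for norm closure. An element $h\in A^{**}$ is strongly lower semicontinuous if $h\in((A_{sa})^m)^-$, and $k$ is strongly upper semicontinuous if $-k$ is strongly lower semicontinuous. Define the following subsets of $A^{**}_{sa}$: - $\overline{S}(A)$ is the norm closed real vector space generated by $((A_{sa})^m)^-$. - $\mathcal U(A)$ is the set of all $x\in A^{**}_{sa}$ such that for every $\epsilon>0$ and every state $\varphi$ of $A$ there are a strongly lower semicontinuous $h$ and a strongly upper semicontinuous $k$ with $k\le x\le h$ and $\varphi(h-k)<\epsilon$. - $\mathcal U_b(A)$ is the set of all $x\in A^{**}_{sa}$ for which there is a constant $\gamma$, depending only on $x$, such that the $h$ and $k$ in the definition of $\mathcal U(A)$ can always be chosen with $\|h\|,\|k\|\le\gamma$; $\overline{\mathcal U}_b(A)$ is the norm closure of $\mathcal U_b(A)$.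 - $\mathcal U_0(A)$ is the monotone sequential closure of $\mathcal U_b(A)$, that is, the smallest set that contains $\mathcal U_b(A)$ and is closed under limits of bounded monotone (increasing or decreasing) sequences. Let $n$ be a natural number, and identify $\mathbb M_n(A^{**})$ with $\mathbb M_n(A)^{**}$ in the canonical way. Let $x=(x_{ij})\in\mathbb M_n(A^{**})$. Then: 1. $x\in\overline S_{\mathbb C}(\mathbb M_n(A))$ if and only if $x_{ij}\in\overline S_{\mathbb C}(A)$ for all $i,j$; 2. $x\in\mathcal U_{b\mathbb C}(\mathbb M_n(A))$ if and only if $x_{ij}\in\mathcal U_{b\mathbb C}(A)$ for all $i,j$; 3. $x\in\overline{\mathcal U}_{b\mathbb C}(\mathbb M_n(A))$ if and only if $x_{ij}\in\overline{\mathcal U}_{b\mathbb C}(A)$ for all $i,j$; 4. $x\in\mathcal U_{0\mathbb C}(\mathbb M_n(A))$ if and only if $x_{ij}\in\mathcal U_{0\mathbb C}(A)$ for all $i,j$; 5. $x\in\mathcal U_{\mathbb C}(\mathbb M_n(A))$ if and only if $x_{ij}\in\mathcal U_{\mathbb C}(A)$ for all $i,j$. -/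

import Mathlib

open Filter Topology

universe u

noncomputable section

namespace UnivMeas

/-- The enveloping von Neumann algebra `A**` of a C*-algebra `A`, realized as the Banach space
bidual of `A` with its norm.  Its normal functionals are exactly the bounded functionals on `A`, so
its σ-weak topology is the topology of pointwise convergence on the dual of `A`. -/
abbrev Bidual (A : Type u) [NonUnitalCStarAlgebra A] : Type u :=
  StrongDual ℂ (StrongDual ℂ A)

section Basic

variable {A : Type u} [NonUnitalCStarAlgebra A]

/-- The adjoint functional `φ*(a) = conj (φ (a*))`. -/
def dualStar (φ : StrongDual ℂ A) : StrongDual ℂ A :=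
  ((starL ℂ : ℂ ≃L⋆[ℂ] ℂ) : ℂ →L⋆[ℂ] ℂ).comp
    (φ.comp ((starL ℂ : A ≃L⋆[ℂ] A) : A →L⋆[ℂ] A))

theorem dualStar_apply (φ : StrongDual ℂ A) (a : A) :
    dualStar φ a = star (φ (star a)) := rfl

/-- A positive functional: `φ (a* a)` is real and nonnegative for every `a`. -/
def IsPositiveFunctional (φ : StrongDual ℂ A) : Prop :=
  ∀ a : A, 0 ≤ (φ (star a * a)).re ∧ (φ (star a * a)).im = 0

/-- A state: a positive functional of norm one. -/
def IsState (φ : StrongDual ℂ A) : Prop :=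
  IsPositiveFunctional φ ∧ ‖φ‖ = 1

/-- `x = x*`, where the involution of `A**` is `x*(φ) = conj (x (φ*))`. -/
def IsSA (x : Bidual A) : Prop :=
  ∀ φ : StrongDual ℂ A, star (x (dualStar φ)) = x φ

/-- The order of `A**`.  The positive functionals on `A` are the positive normal functionals of
`A**`, that is, the vector functionals of the universal representation of `A`, so `x ≤ y` means that
`y - x` is a positive operator in the universal representation. -/
def Le (x y : Bidual A) : Prop :=
  ∀ φ : StrongDual ℂ A, IsPositiveFunctional φ → 0 ≤ ((y - x) φ).re ∧ ((y - x) φ).im = 0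

/-- `σ`-weak convergence in `A**`. -/
def WeakStarTendsto {ι : Type*} (l : Filter ι) (a : ι → Bidual A) (x : Bidual A) : Prop :=
  ∀ φ : StrongDual ℂ A, Tendsto (fun i => a i φ) l (𝓝 (x φ))

/-- `R^m`: the limits of bounded increasing nets from `R`.  (The range of an increasing net is a
directed set with the same limit, so index sets from the universe of `A` suffice.) -/
def incrNetLimits (R : Set (Bidual A)) : Set (Bidual A) :=
  {x | ∃ (ι : Type u) (_ : Preorder ι) (_ : IsDirected ι (· ≤ ·)) (_ : Nonempty ι)
      (a : ι → Bidual A), (∀ i, a i ∈ R) ∧ (∀ i j, i ≤ j → Le (a i) (a j)) ∧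
      (∃ C : ℝ, ∀ i, ‖a i‖ ≤ C) ∧ WeakStarTendsto atTop a x}

/-- The monotone sequential closure of `R`: the smallest set that contains `R` and is closed under
limits of bounded monotone (increasing or decreasing) sequences. -/
inductive MonoSeqClosure (R : Set (Bidual A)) : Bidual A → Prop
  | base (x : Bidual A) (hx : x ∈ R) : MonoSeqClosure R x
  | incr (a : ℕ → Bidual A) (x : Bidual A) (ha : ∀ k, MonoSeqClosure R (a k))
      (hmono : ∀ k, Le (a k) (a (k + 1))) (hbdd : ∃ C : ℝ, ∀ k, ‖a k‖ ≤ C)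
      (hlim : WeakStarTendsto atTop a x) : MonoSeqClosure R x
  | decr (a : ℕ → Bidual A) (x : Bidual A) (ha : ∀ k, MonoSeqClosure R (a k))
      (hmono : ∀ k, Le (a (k + 1)) (a k)) (hbdd : ∃ C : ℝ, ∀ k, ‖a k‖ ≤ C)
      (hlim : WeakStarTendsto atTop a x) : MonoSeqClosure R x

/-- `R_ℂ = R + iR`. -/
def complexify (R : Set (Bidual A)) : Set (Bidual A) :=
  {x | ∃ y ∈ R, ∃ z ∈ R, x = y + Complex.I • z}

end Basic

section Spaces

variable (A : Type u) [NonUnitalCStarAlgebra A]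

/-- The self-adjoint part of `A`, as a subset of `A**` under the canonical embedding. -/
def saPart : Set (Bidual A) :=
  {x | ∃ a : A, IsSelfAdjoint a ∧ NormedSpace.inclusionInDoubleDual ℂ A a = x}

/-- The strongly lower semicontinuous elements: the norm closure of `(A_sa)^m`. -/
def stronglyLSC : Set (Bidual A) :=
  closure (incrNetLimits (saPart A))

/-- The strongly upper semicontinuous elements. -/
def stronglyUSC : Set (Bidual A) :=
  {k | -k ∈ stronglyLSC A}

/-- `S̄`: the norm closed real vector space generated by the strongly lower semicontinuous
elements. -/
def spaceS : Set (Bidual A) :=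
  closure (Submodule.span ℝ (stronglyLSC A) : Set (Bidual A))

/-- `U`: the universally measurable elements. -/
def spaceU : Set (Bidual A) :=
  {x | IsSA x ∧ ∀ ε : ℝ, 0 < ε → ∀ φ : StrongDual ℂ A, IsState φ →
    ∃ h ∈ stronglyLSC A, ∃ k ∈ stronglyUSC A, Le k x ∧ Le x h ∧ ((h - k) φ).re < ε}

/-- `U_b`: as `U`, with a uniform bound on the approximants. -/
def spaceUb : Set (Bidual A) :=
  {x | IsSA x ∧ ∃ γ : ℝ, ∀ ε : ℝ, 0 < ε → ∀ φ : StrongDual ℂ A, IsState φ →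
    ∃ h ∈ stronglyLSC A, ∃ k ∈ stronglyUSC A, Le k x ∧ Le x h ∧ ((h - k) φ).re < ε ∧
      ‖h‖ ≤ γ ∧ ‖k‖ ≤ γ}

/-- The norm closure of `U_b`. -/
def spaceUbBar : Set (Bidual A) :=
  closure (spaceUb A)

/-- `U_0`: the monotone sequential closure of `U_b`. -/
def spaceU0 : Set (Bidual A) :=
  {x | MonoSeqClosure (spaceUb A) x}

end Spaces

section Matrices

variable {A : Type u} [NonUnitalCStarAlgebra A] [PartialOrder A] [StarOrderedRing A] {n : ℕ}

/-- The map `a ↦ a e_ij` from `A` to `M_n(A)`. -/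
def singleL (i j : Fin n) : A →L[ℂ] CStarMatrix (Fin n) (Fin n) A where
  toFun a := CStarMatrix.ofMatrix (Matrix.single i j a)
  map_add' a b := by
    ext k l
    simp [Matrix.single_add]
  map_smul' c a := by
    ext k l
    simp [Matrix.single_apply]
  cont := by
    change Continuous fun a : A => (Matrix.single i j a : Matrix (Fin n) (Fin n) A)
    refine continuous_matrix fun k l => ?_
    simp only [Matrix.single_apply]
    split_ifs <;> fun_prop

/-- The entry map `(a_ij) ↦ a_ij` from `M_n(A)` to `A`. -/
def entryL (i j : Fin n) : CStarMatrix (Fin n) (Fin n) A →L[ℂ] A where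
  toFun a := a i j
  map_add' _ _ := rfl
  map_smul' _ _ := rfl
  cont := by
    change Continuous fun a : Matrix (Fin n) (Fin n) A => a i j
    fun_prop

theorem singleL_apply (i j k l : Fin n) (a : A) :
    singleL i j a k l = if i = k ∧ j = l then a else 0 := by
  change Matrix.single i j a k l = _
  rw [Matrix.single_apply]

theorem sum_singleL_entryL (a : CStarMatrix (Fin n) (Fin n) A) :
    ∑ i, ∑ j, singleL i j (entryL i j a) = a :=
  (Matrix.matrix_eq_sum_single (a : Matrix (Fin n) (Fin n) A)).symm

/-- The canonical identification `M_n(A**) = M_n(A)**`: the matrix `(x_ij)` is the element of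
`M_n(A)**` that takes the value `∑ x_ij (a ↦ φ (a e_ij))` at `φ`.  It is the σ-weakly continuous
extension of the identity of `M_n(A)`. -/
def matrixBidual :
    Matrix (Fin n) (Fin n) (Bidual A) ≃ₗ[ℂ] Bidual (CStarMatrix (Fin n) (Fin n) A) where
  toFun x := ∑ i, ∑ j, (x i j).comp
    (ContinuousLinearMap.precomp ℂ (singleL i j : A →L[ℂ] CStarMatrix (Fin n) (Fin n) A))
  invFun y := fun i j => y.comp
    (ContinuousLinearMap.precomp ℂ (entryL i j : CStarMatrix (Fin n) (Fin n) A →L[ℂ] A))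
  map_add' x y := by
    simp [ContinuousLinearMap.add_comp, Finset.sum_add_distrib]
  map_smul' c x := by
    simp [ContinuousLinearMap.smul_comp, Finset.smul_sum]
  left_inv x := by
    funext k l
    ext φ
    have h : ∀ i j : Fin n, (φ.comp (entryL k l)).comp (singleL i j) =
        if i = k ∧ j = l then φ else 0 := by
      intro i j
      ext a
      change φ (singleL i j a k l) = _
      rw [singleL_apply]
      split_ifs <;> simp
    simp only [ContinuousLinearMap.comp_apply, sum_apply,
      ContinuousLinearMap.precomp_apply, h]
    rw [Finset.sum_eq_single k, Finset.sum_eq_single l]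
    · simp
    · intro j _ hj
      simp [hj]
    · simp
    · intro i _ hi
      simp [hi]
    · simp
  right_inv y := by
    ext φ
    simp only [ContinuousLinearMap.comp_apply, sum_apply,
      ContinuousLinearMap.precomp_apply]
    simp only [← map_sum]
    congr 1
    ext a
    simp only [ContinuousLinearMap.comp_apply, sum_apply]
    simp only [← map_sum]
    rw [sum_singleL_entryL]

theorem matrixBidual_apply (x : Matrix (Fin n) (Fin n) (Bidual A))
    (φ : StrongDual ℂ (CStarMatrix (Fin n) (Fin n) A)) :
    matrixBidual x φ = ∑ i, ∑ j, x i j (φ.comp (singleL i j)) := by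
  change (∑ i, ∑ j, (x i j).comp (ContinuousLinearMap.precomp ℂ (singleL i j))) φ = _
  simp only [ContinuousLinearMap.comp_apply, sum_apply,
      ContinuousLinearMap.precomp_apply]

/-- On `M_n(A)` the identification is the canonical embedding. -/
theorem matrixBidual_inclusion (a : CStarMatrix (Fin n) (Fin n) A) :
    matrixBidual (Matrix.of fun i j => NormedSpace.inclusionInDoubleDual ℂ A (entryL i j a)) =
      NormedSpace.inclusionInDoubleDual ℂ (CStarMatrix (Fin n) (Fin n) A) a := by
  ext φ
  rw [matrixBidual_apply, NormedSpace.dual_def]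
  simp only [Matrix.of_apply, NormedSpace.dual_def, ContinuousLinearMap.comp_apply]
  simp only [← map_sum]
  exact congrArg φ (sum_singleL_entryL a)

end Matrices

end UnivMeas

end

/-!
A bounded `*`-map `T : A → B` that pulls positive functionals back to positive functionals has a
bidual `T** : A** → B**` that is bounded, σ-weakly continuous, order preserving, and maps `A_sa`
into `B_sa`. Hence `T**` maps each of the five spaces of `A` into the corresponding space of `B`
(`IsPositiveStarMap.map_spaceS` and its companions). Two families of such maps link `A` and
`M_n(A)`, indexed by scalar vectors `v`: the maps `a ↦ (conj v_i v_j a)` (`inflate`) and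
`(a_ij) ↦ ∑ conj v_i v_j a_ij` (`compress`). By polarization, every embedding `a ↦ a e_ij` and
every entry map `(a_ij) ↦ a_ij` is a complex linear combination of four maps from these families.

Each of the five spaces is a real vector space, so its complexification is a complex vector space,
and the polarization identity carries membership back and forth
(`matrixBidual_mem_complexify_iff`). No multiplication on the bidual is needed.

In the definition of `U` and `U_b` the states may be replaced by all positive functionals
(`IsSandwiched`, `mem_spaceU_iff`, `mem_spaceUb_iff`), which is what allows functionals to be pulled
back along positive maps and the approximants to be scaled freely.
-/

open scoped ENNReal

noncomputable section

namespace UnivMeas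

-- Shortcuts: unification does not identify the group structures of a double dual on its own.
local instance (priority := 10000) (A : Type u) [NonUnitalCStarAlgebra A] :
    AddCommGroup (Bidual A) := inferInstance

local instance (priority := 10000) (A : Type u) [NonUnitalCStarAlgebra A] :
    NormedAddCommGroup (Bidual A) := inferInstance

local instance (priority := 10000) (A : Type u) [NonUnitalCStarAlgebra A] :
    NormedSpace ℝ (Bidual A) := inferInstance

/-! ### The order on the bidual -/

section Order

variable {A : Type u} [NonUnitalCStarAlgebra A]

theorem IsPositiveFunctional.smul {φ : StrongDual ℂ A} (hφ : IsPositiveFunctional φ) {c : ℝ}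
    (hc : 0 ≤ c) : IsPositiveFunctional (c • φ) := fun a => by
  obtain ⟨h1, h2⟩ := hφ a
  simp only [smul_apply, Complex.smul_re, Complex.smul_im, h2, smul_eq_mul,
    mul_zero, and_true]
  positivity

theorem Le.add {x y x' y' : Bidual A} (h : Le x y) (h' : Le x' y') : Le (x + x') (y + y') := by
  intro φ hφ
  obtain ⟨h1, h2⟩ := h φ hφ
  obtain ⟨h3, h4⟩ := h' φ hφ
  rw [add_sub_add_comm, add_apply, Complex.add_re, Complex.add_im, h2, h4]
  exact ⟨add_nonneg h1 h3, add_zero 0⟩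

theorem Le.refl (x : Bidual A) : Le x x := fun φ _ => by simp

theorem Le.neg {x y : Bidual A} (h : Le x y) : Le (-y) (-x) := by
  intro φ hφ
  rw [neg_sub_neg]
  exact h φ hφ

theorem Le.smul {x y : Bidual A} (h : Le x y) {c : ℝ} (hc : 0 ≤ c) : Le (c • x) (c • y) := by
  intro φ hφ
  obtain ⟨h1, h2⟩ := h φ hφ
  rw [← smul_sub, smul_apply, Complex.smul_re, Complex.smul_im, h2,
    smul_zero]
  exact ⟨smul_nonneg hc h1, rfl⟩

theorem IsSA.zero : IsSA (0 : Bidual A) := fun φ => by simp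

theorem IsSA.add {x y : Bidual A} (hx : IsSA x) (hy : IsSA y) : IsSA (x + y) := fun φ => by
  simp only [add_apply, star_add, hx φ, hy φ]

theorem IsSA.smul {x : Bidual A} (hx : IsSA x) (c : ℝ) : IsSA (c • x) := fun φ => by
  simp only [smul_apply, star_smul, hx φ, star_trivial]

theorem WeakStarTendsto.smul {ι : Type*} {l : Filter ι} {a : ι → Bidual A} {x : Bidual A}
    (h : WeakStarTendsto l a x) (c : ℝ) : WeakStarTendsto l (fun i => c • a i) (c • x) :=
  fun φ => (h φ).const_smul c

theorem WeakStarTendsto.const_add {ι : Type*} {l : Filter ι} {a : ι → Bidual A} {x : Bidual A}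
    (h : WeakStarTendsto l a x) (y : Bidual A) :
    WeakStarTendsto l (fun i => y + a i) (y + x) :=
  fun φ => (h φ).const_add (y φ)

end Order

/-! ### Semicontinuous elements -/

section Semicontinuous

variable {A : Type u} [NonUnitalCStarAlgebra A]

theorem zero_mem_saPart : (0 : Bidual A) ∈ saPart A := ⟨0, IsSelfAdjoint.zero A, map_zero _⟩

theorem add_mem_saPart {x y : Bidual A} (hx : x ∈ saPart A) (hy : y ∈ saPart A) :
    x + y ∈ saPart A := by
  obtain ⟨a, ha, rfl⟩ := hx
  obtain ⟨b, hb, rfl⟩ := hy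
  exact ⟨a + b, ha.add hb, map_add _ _ _⟩

theorem smul_mem_saPart {x : Bidual A} (hx : x ∈ saPart A) (c : ℝ) : c • x ∈ saPart A := by
  obtain ⟨a, ha, rfl⟩ := hx
  refine ⟨(c : ℂ) • a, ?_, ?_⟩
  · rw [isSelfAdjoint_iff, star_smul, ha.star_eq]
    simp
  · rw [map_smul, Complex.coe_smul]

theorem subset_incrNetLimits (R : Set (Bidual A)) : R ⊆ incrNetLimits R := fun x hx =>
  ⟨PUnit, inferInstance, inferInstance, inferInstance, fun _ => x, fun _ => hx,
    fun _ _ _ => Le.refl x, ⟨‖x‖, fun _ => le_rfl⟩, fun _ => tendsto_const_nhds⟩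

theorem add_mem_incrNetLimits {R : Set (Bidual A)} (hR : ∀ x ∈ R, ∀ y ∈ R, x + y ∈ R)
    {x y : Bidual A} (hx : x ∈ incrNetLimits R) (hy : y ∈ incrNetLimits R) :
    x + y ∈ incrNetLimits R := by
  obtain ⟨ι, _, _, _, a, haR, ha, ⟨C, hC⟩, hax⟩ := hx
  obtain ⟨κ, _, _, _, b, hbR, hb, ⟨D, hD⟩, hby⟩ := hy
  have hdir : IsDirected (ι × κ) (· ≤ ·) := ⟨fun p q => by
    obtain ⟨i, hi, hi'⟩ := directed_of (· ≤ ·) p.1 q.1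
    obtain ⟨j, hj, hj'⟩ := directed_of (· ≤ ·) p.2 q.2
    exact ⟨(i, j), ⟨hi, hj⟩, ⟨hi', hj'⟩⟩⟩
  refine ⟨ι × κ, inferInstance, hdir, inferInstance, fun p => a p.1 + b p.2,
    fun p => hR _ (haR _) _ (hbR _), fun p q hpq => (ha _ _ hpq.1).add (hb _ _ hpq.2),
    ⟨C + D, fun p => norm_add_le_of_le (hC _) (hD _)⟩, fun φ => ?_⟩
  rw [← prod_atTop_atTop_eq]
  exact ((hax φ).comp tendsto_fst).add ((hby φ).comp tendsto_snd)

theorem smul_mem_incrNetLimits {R : Set (Bidual A)} {c : ℝ} (hc : 0 ≤ c)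
    (hR : ∀ x ∈ R, c • x ∈ R) {x : Bidual A} (hx : x ∈ incrNetLimits R) :
    c • x ∈ incrNetLimits R := by
  obtain ⟨ι, _, _, _, a, haR, ha, ⟨C, hC⟩, hax⟩ := hx
  refine ⟨ι, inferInstance, inferInstance, inferInstance, fun i => c • a i,
    fun i => hR _ (haR i), fun i j hij => (ha i j hij).smul hc,
    ⟨c * C, fun i => ?_⟩, hax.smul c⟩
  rw [norm_smul, Real.norm_of_nonneg hc]
  exact mul_le_mul_of_nonneg_left (hC i) hc

theorem zero_mem_stronglyLSC : (0 : Bidual A) ∈ stronglyLSC A :=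
  subset_closure (subset_incrNetLimits _ zero_mem_saPart)

theorem add_mem_stronglyLSC {x y : Bidual A} (hx : x ∈ stronglyLSC A) (hy : y ∈ stronglyLSC A) :
    x + y ∈ stronglyLSC A :=
  map_mem_closure₂ continuous_add hx hy fun _ ha _ hb =>
    add_mem_incrNetLimits (fun _ h _ h' => add_mem_saPart h h') ha hb

theorem smul_mem_stronglyLSC {x : Bidual A} (hx : x ∈ stronglyLSC A) {c : ℝ} (hc : 0 ≤ c) :
    c • x ∈ stronglyLSC A :=
  map_mem_closure (continuous_const_smul c) hx fun _ ha =>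
    smul_mem_incrNetLimits hc (fun _ h => smul_mem_saPart h c) ha

theorem neg_mem_stronglyUSC {x : Bidual A} (hx : x ∈ stronglyLSC A) : -x ∈ stronglyUSC A := by
  rwa [stronglyUSC, Set.mem_ofPred_eq, neg_neg]

theorem zero_mem_stronglyUSC : (0 : Bidual A) ∈ stronglyUSC A := by
  simpa using neg_mem_stronglyUSC (zero_mem_stronglyLSC (A := A))

theorem add_mem_stronglyUSC {x y : Bidual A} (hx : x ∈ stronglyUSC A) (hy : y ∈ stronglyUSC A) :
    x + y ∈ stronglyUSC A := by
  rw [stronglyUSC, Set.mem_ofPred_eq, neg_add]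
  exact add_mem_stronglyLSC hx hy

theorem smul_mem_stronglyUSC {x : Bidual A} (hx : x ∈ stronglyUSC A) {c : ℝ} (hc : 0 ≤ c) :
    c • x ∈ stronglyUSC A := by
  rw [stronglyUSC, Set.mem_ofPred_eq, ← smul_neg]
  exact smul_mem_stronglyLSC hx hc

end Semicontinuous

/-! ### Approximation from both sides by semicontinuous elements -/

section Sandwiched

variable {A : Type u} [NonUnitalCStarAlgebra A]

/-- `x` is self-adjoint and, for every positive functional, can be enclosed arbitrarily tightly
between a strongly upper and a strongly lower semicontinuous element of norm at most `B`. The bound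
is extended nonnegative: `B = ∞` gives `U`, and finite `B` give `U_b`. -/
def IsSandwiched (B : ℝ≥0∞) (x : Bidual A) : Prop :=
  IsSA x ∧ ∀ ε : ℝ, 0 < ε → ∀ φ : StrongDual ℂ A, IsPositiveFunctional φ →
    ∃ h ∈ stronglyLSC A, ∃ k ∈ stronglyUSC A, Le k x ∧ Le x h ∧ ((h - k) φ).re < ε ∧
      ‖h‖ₑ ≤ B ∧ ‖k‖ₑ ≤ B

/-- Enclosing with respect to states is enough: a nonzero positive functional is a multiple of a
state, and for the zero functional any enclosure serves. -/
theorem isSandwiched_of_isState {B : ℝ≥0∞} {x : Bidual A} (hx : IsSA x)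
    (H : ∀ ε : ℝ, 0 < ε → ∀ φ : StrongDual ℂ A, IsState φ →
      ∃ h ∈ stronglyLSC A, ∃ k ∈ stronglyUSC A, Le k x ∧ Le x h ∧ ((h - k) φ).re < ε ∧
        ‖h‖ₑ ≤ B ∧ ‖k‖ₑ ≤ B) : IsSandwiched B x := by
  have hstate : ∀ φ : StrongDual ℂ A, IsPositiveFunctional φ → φ ≠ 0 → IsState (‖φ‖⁻¹ • φ) :=
    fun φ hφ h0 => ⟨hφ.smul (by positivity), by
      rw [norm_smul, norm_inv, norm_norm, inv_mul_cancel₀ (norm_ne_zero_iff.mpr h0)]⟩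
  refine ⟨hx, fun ε hε φ hφ => ?_⟩
  by_cases h0 : φ = 0
  · by_cases hA : ∃ ψ : StrongDual ℂ A, IsState ψ
    · obtain ⟨ψ, hψ⟩ := hA
      obtain ⟨h, hh, k, hk, hkx, hxh, -, hb⟩ := H ε hε ψ hψ
      exact ⟨h, hh, k, hk, hkx, hxh, by simpa [h0] using hε, hb⟩
    · -- Without states, `0` is the only positive functional, and the order is the full relation.
      have hz : ∀ ψ : StrongDual ℂ A, IsPositiveFunctional ψ → ψ = 0 := fun ψ hψ => by
        by_contra hne
        exact hA ⟨_, hstate ψ hψ hne⟩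
      have hle : ∀ y z : Bidual A, Le y z := fun y z ψ hψ => by simp [hz ψ hψ]
      exact ⟨0, zero_mem_stronglyLSC, 0, zero_mem_stronglyUSC, hle _ _, hle _ _,
        by simpa using hε, by simp, by simp⟩
  · have hpos : 0 < ‖φ‖ := norm_pos_iff.mpr h0
    obtain ⟨h, hh, k, hk, hkx, hxh, hlt, hb⟩ :=
      H (‖φ‖⁻¹ * ε) (by positivity) _ (hstate φ hφ h0)
    refine ⟨h, hh, k, hk, hkx, hxh, ?_, hb⟩
    rw [ContinuousLinearMap.map_smul_of_tower, Complex.smul_re, smul_eq_mul] at hlt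
    exact lt_of_mul_lt_mul_left hlt (by positivity)

theorem mem_spaceU_iff {x : Bidual A} : x ∈ spaceU A ↔ IsSandwiched ⊤ x := by
  constructor
  · rintro ⟨hx, H⟩
    refine isSandwiched_of_isState hx fun ε hε φ hφ => ?_
    obtain ⟨h, hh, k, hk, hkx, hxh, hlt⟩ := H ε hε φ hφ
    exact ⟨h, hh, k, hk, hkx, hxh, hlt, le_top, le_top⟩
  · rintro ⟨hx, H⟩
    refine ⟨hx, fun ε hε φ hφ => ?_⟩
    obtain ⟨h, hh, k, hk, hkx, hxh, hlt, -⟩ := H ε hε φ hφ.1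
    exact ⟨h, hh, k, hk, hkx, hxh, hlt⟩

theorem mem_spaceUb_iff {x : Bidual A} : x ∈ spaceUb A ↔ ∃ B, B ≠ ⊤ ∧ IsSandwiched B x := by
  constructor
  · rintro ⟨hx, γ, H⟩
    refine ⟨ENNReal.ofReal γ, ENNReal.ofReal_ne_top, isSandwiched_of_isState hx fun ε hε φ hφ => ?_⟩
    obtain ⟨h, hh, k, hk, hkx, hxh, hlt, hb, hb'⟩ := H ε hε φ hφ
    refine ⟨h, hh, k, hk, hkx, hxh, hlt, ?_, ?_⟩ <;> rw [← ofReal_norm] <;>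
      exact ENNReal.ofReal_le_ofReal ‹_›
  · rintro ⟨B, hB, hx, H⟩
    refine ⟨hx, B.toReal, fun ε hε φ hφ => ?_⟩
    obtain ⟨h, hh, k, hk, hkx, hxh, hlt, hb, hb'⟩ := H ε hε φ hφ.1
    refine ⟨h, hh, k, hk, hkx, hxh, hlt, ?_, ?_⟩ <;> rw [← toReal_enorm] <;>
      exact ENNReal.toReal_mono hB ‹_›

theorem IsSandwiched.mono {B B' : ℝ≥0∞} {x : Bidual A} (hx : IsSandwiched B x) (hB : B ≤ B') :
    IsSandwiched B' x := by
  refine ⟨hx.1, fun ε hε φ hφ => ?_⟩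
  obtain ⟨h, hh, k, hk, hkx, hxh, hlt, hb, hb'⟩ := hx.2 ε hε φ hφ
  exact ⟨h, hh, k, hk, hkx, hxh, hlt, hb.trans hB, hb'.trans hB⟩

theorem IsSandwiched.zero : IsSandwiched 0 (0 : Bidual A) :=
  ⟨IsSA.zero, fun ε hε _ _ => ⟨0, zero_mem_stronglyLSC, 0, zero_mem_stronglyUSC, Le.refl 0,
    Le.refl 0, by simpa using hε, by simp, by simp⟩⟩

theorem IsSandwiched.add {B B' : ℝ≥0∞} {x y : Bidual A} (hx : IsSandwiched B x)
    (hy : IsSandwiched B' y) : IsSandwiched (B + B') (x + y) := by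
  refine ⟨hx.1.add hy.1, fun ε hε φ hφ => ?_⟩
  obtain ⟨h, hh, k, hk, hkx, hxh, hlt, hb, hb'⟩ := hx.2 (ε / 2) (half_pos hε) φ hφ
  obtain ⟨h', hh', k', hk', hkx', hxh', hlt', hc, hc'⟩ := hy.2 (ε / 2) (half_pos hε) φ hφ
  refine ⟨h + h', add_mem_stronglyLSC hh hh', k + k', add_mem_stronglyUSC hk hk', hkx.add hkx',
    hxh.add hxh', ?_, (enorm_add_le _ _).trans (add_le_add hb hc),
    (enorm_add_le _ _).trans (add_le_add hb' hc')⟩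
  rw [add_sub_add_comm, add_apply, Complex.add_re]
  linarith

theorem IsSandwiched.neg {B : ℝ≥0∞} {x : Bidual A} (hx : IsSandwiched B x) :
    IsSandwiched B (-x) := by
  refine ⟨by simpa using hx.1.smul (-1), fun ε hε φ hφ => ?_⟩
  obtain ⟨h, hh, k, hk, hkx, hxh, hlt, hb, hb'⟩ := hx.2 ε hε φ hφ
  exact ⟨-k, hk, -h, neg_mem_stronglyUSC hh, hxh.neg, hkx.neg, by rwa [neg_sub_neg],
    by rwa [enorm_neg], by rwa [enorm_neg]⟩

theorem IsSandwiched.smul_of_nonneg {B : ℝ≥0∞} {x : Bidual A} (hx : IsSandwiched B x) {c : ℝ}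
    (hc : 0 ≤ c) : IsSandwiched (‖c‖ₑ * B) (c • x) := by
  refine ⟨hx.1.smul c, fun ε hε φ hφ => ?_⟩
  obtain ⟨h, hh, k, hk, hkx, hxh, hlt, hb, hb'⟩ := hx.2 ε hε (c • φ) (hφ.smul hc)
  refine ⟨c • h, smul_mem_stronglyLSC hh hc, c • k, smul_mem_stronglyUSC hk hc, hkx.smul hc,
    hxh.smul hc, ?_, ?_, ?_⟩
  · rw [← smul_sub, smul_apply]
    rwa [ContinuousLinearMap.map_smul_of_tower] at hlt
  · rw [enorm_smul]
    exact mul_le_mul_right hb _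
  · rw [enorm_smul]
    exact mul_le_mul_right hb' _

theorem IsSandwiched.smul {B : ℝ≥0∞} {x : Bidual A} (hx : IsSandwiched B x) (c : ℝ) :
    IsSandwiched (‖c‖ₑ * B) (c • x) := by
  rcases le_total 0 c with hc | hc
  · exact hx.smul_of_nonneg hc
  · simpa using hx.neg.smul_of_nonneg (neg_nonneg.mpr hc)

end Sandwiched

/-! ### Monotone sequential closures -/

section MonoSeqClosure

variable {A : Type u} [NonUnitalCStarAlgebra A]

theorem MonoSeqClosure.smul_of_nonneg {R : Set (Bidual A)} {c : ℝ} (hc : 0 ≤ c)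
    (hR : ∀ x ∈ R, c • x ∈ R) {x : Bidual A} (hx : MonoSeqClosure R x) :
    MonoSeqClosure R (c • x) := by
  have hbd : ∀ a : ℕ → Bidual A, (∃ C : ℝ, ∀ k, ‖a k‖ ≤ C) → ∃ C : ℝ, ∀ k, ‖c • a k‖ ≤ C := by
    rintro a ⟨C, hC⟩
    exact ⟨‖c‖ * C, fun k => (norm_smul c (a k)).trans_le
      (mul_le_mul_of_nonneg_left (hC k) (norm_nonneg c))⟩
  induction hx with
  | base x hx => exact .base _ (hR x hx)
  | incr a x _ hm hb hl ih =>
    exact .incr (fun k => c • a k) _ ih (fun k => (hm k).smul hc) (hbd a hb) (hl.smul c)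
  | decr a x _ hm hb hl ih =>
    exact .decr (fun k => c • a k) _ ih (fun k => (hm k).smul hc) (hbd a hb) (hl.smul c)

theorem MonoSeqClosure.neg {R : Set (Bidual A)} (hR : ∀ x ∈ R, -x ∈ R) {x : Bidual A}
    (hx : MonoSeqClosure R x) : MonoSeqClosure R (-x) := by
  induction hx with
  | base x hx => exact .base _ (hR x hx)
  | incr a x _ hm hb hl ih =>
    exact .decr (fun k => -a k) _ ih (fun k => (hm k).neg) (by simpa only [norm_neg] using hb)
      (fun φ => (hl φ).neg)
  | decr a x _ hm hb hl ih =>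
    exact .incr (fun k => -a k) _ ih (fun k => (hm k).neg) (by simpa only [norm_neg] using hb)
      (fun φ => (hl φ).neg)

/-- The translates of the closure by `x` absorb the closure of `R` as soon as they absorb `R`. -/
theorem MonoSeqClosure.const_add {R : Set (Bidual A)} {x : Bidual A}
    (hx : ∀ y ∈ R, MonoSeqClosure R (x + y)) {y : Bidual A} (hy : MonoSeqClosure R y) :
    MonoSeqClosure R (x + y) := by
  have hbd : ∀ a : ℕ → Bidual A, (∃ C : ℝ, ∀ k, ‖a k‖ ≤ C) → ∃ C : ℝ, ∀ k, ‖x + a k‖ ≤ C := by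
    rintro a ⟨C, hC⟩
    exact ⟨‖x‖ + C, fun k => norm_add_le_of_le le_rfl (hC k)⟩
  induction hy with
  | base y hy => exact hx y hy
  | incr a y _ hm hb hl ih =>
    exact .incr (fun k => x + a k) _ ih (fun k => (Le.refl x).add (hm k)) (hbd a hb)
      (hl.const_add x)
  | decr a y _ hm hb hl ih =>
    exact .decr (fun k => x + a k) _ ih (fun k => (Le.refl x).add (hm k)) (hbd a hb)
      (hl.const_add x)

theorem MonoSeqClosure.add {R : Set (Bidual A)} (hR : ∀ x ∈ R, ∀ y ∈ R, x + y ∈ R)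
    {x y : Bidual A} (hx : MonoSeqClosure R x) (hy : MonoSeqClosure R y) :
    MonoSeqClosure R (x + y) := by
  refine const_add (fun z hz => ?_) hy
  rw [add_comm]
  exact const_add (fun w hw => .base _ (hR z hz w hw)) hx

end MonoSeqClosure

/-! ### The five spaces as real vector spaces -/

section Submodules

variable (A : Type u) [NonUnitalCStarAlgebra A]

/-- `S̄(A)` as a real subspace of `A**`. -/
def submoduleS : Submodule ℝ (Bidual A) :=
  (Submodule.span ℝ (stronglyLSC A)).topologicalClosure

/-- `U(A)` as a real subspace of `A**`. -/
def submoduleU : Submodule ℝ (Bidual A) where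
  carrier := spaceU A
  zero_mem' := mem_spaceU_iff.mpr (IsSandwiched.zero.mono le_top)
  add_mem' hx hy := mem_spaceU_iff.mpr
    (((mem_spaceU_iff.mp hx).add (mem_spaceU_iff.mp hy)).mono le_top)
  smul_mem' c _ hx := mem_spaceU_iff.mpr (((mem_spaceU_iff.mp hx).smul c).mono le_top)

/-- `U_b(A)` as a real subspace of `A**`. -/
def submoduleUb : Submodule ℝ (Bidual A) where
  carrier := spaceUb A
  zero_mem' := mem_spaceUb_iff.mpr ⟨0, ENNReal.zero_ne_top, IsSandwiched.zero⟩
  add_mem' hx hy := by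
    obtain ⟨B, hB, hx⟩ := mem_spaceUb_iff.mp hx
    obtain ⟨B', hB', hy⟩ := mem_spaceUb_iff.mp hy
    exact mem_spaceUb_iff.mpr ⟨B + B', ENNReal.add_ne_top.mpr ⟨hB, hB'⟩, hx.add hy⟩
  smul_mem' c _ hx := by
    obtain ⟨B, hB, hx⟩ := mem_spaceUb_iff.mp hx
    exact mem_spaceUb_iff.mpr ⟨‖c‖ₑ * B, ENNReal.mul_ne_top enorm_ne_top hB, hx.smul c⟩

/-- The norm closure of `U_b(A)` as a real subspace of `A**`. -/
def submoduleUbBar : Submodule ℝ (Bidual A) := (submoduleUb A).topologicalClosure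

/-- `U_0(A)` as a real subspace of `A**`. -/
def submoduleU0 : Submodule ℝ (Bidual A) where
  carrier := spaceU0 A
  zero_mem' := .base _ (submoduleUb A).zero_mem
  add_mem' := MonoSeqClosure.add fun _ hx _ hy => (submoduleUb A).add_mem hx hy
  smul_mem' c x hx := by
    rcases le_total 0 c with hc | hc
    · exact hx.smul_of_nonneg hc fun _ hy => (submoduleUb A).smul_mem c hy
    · have h := (MonoSeqClosure.neg (fun _ hy => (submoduleUb A).neg_mem hy) hx).smul_of_nonneg
        (neg_nonneg.mpr hc) fun _ hy => (submoduleUb A).smul_mem (-c) hy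
      rwa [neg_smul_neg] at h

variable {A}

/-- The complexification of a real subspace of `A**`, a complex subspace. -/
def complexifySubmodule (X : Submodule ℝ (Bidual A)) : Submodule ℂ (Bidual A) where
  carrier := complexify X
  zero_mem' := ⟨0, X.zero_mem, 0, X.zero_mem, by simp⟩
  add_mem' := by
    rintro _ _ ⟨y, hy, z, hz, rfl⟩ ⟨y', hy', z', hz', rfl⟩
    exact ⟨y + y', X.add_mem hy hy', z + z', X.add_mem hz hz', by
      rw [smul_add, add_add_add_comm]⟩
  smul_mem' := by
    rintro c _ ⟨y, hy, z, hz, rfl⟩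
    refine ⟨c.re • y - c.im • z, X.sub_mem (X.smul_mem _ hy) (X.smul_mem _ hz),
      c.im • y + c.re • z, X.add_mem (X.smul_mem _ hy) (X.smul_mem _ hz), ?_⟩
    ext φ
    simp only [add_apply, sub_apply,
      smul_apply, Complex.real_smul, smul_eq_mul]
    linear_combination (y φ + Complex.I * z φ) * (Complex.re_add_im c).symm +
      (c.im : ℂ) * z φ * Complex.I_mul_I

theorem mem_complexifySubmodule {X : Submodule ℝ (Bidual A)} {x : Bidual A} :
    x ∈ complexifySubmodule X ↔ x ∈ complexify (X : Set (Bidual A)) := Iff.rfl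

end Submodules

/-! ### Biduals of positive maps -/

section PositiveMaps

variable {A B : Type u} [NonUnitalCStarAlgebra A] [NonUnitalCStarAlgebra B]

/-- The bidual `T** : A** → B**` of a bounded linear map, `(T** x) φ = x (φ ∘ T)`. -/
def bidualMap (T : A →L[ℂ] B) : Bidual A →L[ℂ] Bidual B :=
  ContinuousLinearMap.precomp ℂ (ContinuousLinearMap.precomp ℂ T)

theorem bidualMap_apply (T : A →L[ℂ] B) (x : Bidual A) (φ : StrongDual ℂ B) :
    bidualMap T x φ = x (φ.comp T) := rfl

theorem norm_bidualMap_le (T : A →L[ℂ] B) (x : Bidual A) : ‖bidualMap T x‖ ≤ ‖T‖ * ‖x‖ := by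
  refine ContinuousLinearMap.opNorm_le_bound _ (by positivity) fun φ => ?_
  rw [bidualMap_apply]
  calc ‖x (φ.comp T)‖ ≤ ‖x‖ * (‖φ‖ * ‖T‖) :=
        x.le_opNorm_of_le (ContinuousLinearMap.opNorm_comp_le φ T)
    _ = ‖T‖ * ‖x‖ * ‖φ‖ := by ring

theorem enorm_bidualMap_le (T : A →L[ℂ] B) (x : Bidual A) :
    ‖bidualMap T x‖ₑ ≤ ‖T‖ₑ * ‖x‖ₑ := by
  simp only [← ofReal_norm]
  rw [← ENNReal.ofReal_mul (norm_nonneg T)]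
  exact ENNReal.ofReal_le_ofReal (norm_bidualMap_le T x)

theorem bidualMap_sum_smul {ι : Type*} (s : Finset ι) (c : ι → ℂ) (T : ι → A →L[ℂ] B)
    (x : Bidual A) : bidualMap (∑ i ∈ s, c i • T i) x = ∑ i ∈ s, c i • bidualMap (T i) x := by
  ext φ
  have h : φ.comp (∑ i ∈ s, c i • T i) = ∑ i ∈ s, c i • φ.comp (T i) := by
    ext a
    simp
  simp [bidualMap_apply, h]

theorem bidualMap_mem_complexify {T : A →L[ℂ] B} {X : Set (Bidual A)} {Y : Set (Bidual B)}
    (hT : ∀ y ∈ X, bidualMap T y ∈ Y) {x : Bidual A} (hx : x ∈ complexify X) :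
    bidualMap T x ∈ complexify Y := by
  obtain ⟨y, hy, z, hz, rfl⟩ := hx
  exact ⟨_, hT y hy, _, hT z hz, by rw [map_add, map_smul]⟩

/-- A bounded `*`-preserving map along which positive functionals pull back to positive
functionals. -/
structure IsPositiveStarMap (T : A →L[ℂ] B) : Prop where
  map_star (a : A) : T (star a) = star (T a)
  comp (φ : StrongDual ℂ B) (hφ : IsPositiveFunctional φ) : IsPositiveFunctional (φ.comp T)

namespace IsPositiveStarMap

variable {T : A →L[ℂ] B}

theorem map_le (hT : IsPositiveStarMap T) {x y : Bidual A} (h : Le x y) :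
    Le (bidualMap T x) (bidualMap T y) := fun φ hφ => h (φ.comp T) (hT.comp φ hφ)

theorem map_isSA (hT : IsPositiveStarMap T) {x : Bidual A} (hx : IsSA x) :
    IsSA (bidualMap T x) := fun φ => by
  have h : (dualStar φ).comp T = dualStar (φ.comp T) := by
    ext a
    simp only [ContinuousLinearMap.comp_apply, dualStar_apply, hT.map_star]
  rw [bidualMap_apply, h, hx, bidualMap_apply]

theorem map_saPart (hT : IsPositiveStarMap T) {x : Bidual A} (hx : x ∈ saPart A) :
    bidualMap T x ∈ saPart B := by
  obtain ⟨a, ha, rfl⟩ := hx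
  exact ⟨T a, by rw [isSelfAdjoint_iff, ← hT.map_star, ha.star_eq], rfl⟩

theorem map_incrNetLimits (hT : IsPositiveStarMap T) {R : Set (Bidual A)} {R' : Set (Bidual B)}
    (hR : ∀ x ∈ R, bidualMap T x ∈ R') {x : Bidual A} (hx : x ∈ incrNetLimits R) :
    bidualMap T x ∈ incrNetLimits R' := by
  obtain ⟨ι, _, _, _, a, haR, ha, ⟨C, hC⟩, hax⟩ := hx
  exact ⟨ι, inferInstance, inferInstance, inferInstance, fun i => bidualMap T (a i),
    fun i => hR _ (haR i), fun i j hij => hT.map_le (ha i j hij),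
    ⟨‖T‖ * C, fun i => (norm_bidualMap_le T (a i)).trans
      (mul_le_mul_of_nonneg_left (hC i) (norm_nonneg T))⟩, fun φ => hax (φ.comp T)⟩

theorem map_stronglyLSC (hT : IsPositiveStarMap T) {x : Bidual A} (hx : x ∈ stronglyLSC A) :
    bidualMap T x ∈ stronglyLSC B :=
  map_mem_closure (bidualMap T).continuous hx fun _ h =>
    hT.map_incrNetLimits (fun _ => hT.map_saPart) h

theorem map_stronglyUSC (hT : IsPositiveStarMap T) {x : Bidual A} (hx : x ∈ stronglyUSC A) :
    bidualMap T x ∈ stronglyUSC B := by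
  rw [stronglyUSC, Set.mem_ofPred_eq, ← map_neg]
  exact hT.map_stronglyLSC hx

theorem map_isSandwiched (hT : IsPositiveStarMap T) {C : ℝ≥0∞} {x : Bidual A}
    (hx : IsSandwiched C x) : IsSandwiched (‖T‖ₑ * C) (bidualMap T x) := by
  refine ⟨hT.map_isSA hx.1, fun ε hε φ hφ => ?_⟩
  obtain ⟨h, hh, k, hk, hkx, hxh, hlt, hb, hb'⟩ := hx.2 ε hε (φ.comp T) (hT.comp φ hφ)
  exact ⟨bidualMap T h, hT.map_stronglyLSC hh, bidualMap T k, hT.map_stronglyUSC hk,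
    hT.map_le hkx, hT.map_le hxh, hlt,
    (enorm_bidualMap_le T h).trans (mul_le_mul_right hb _),
    (enorm_bidualMap_le T k).trans (mul_le_mul_right hb' _)⟩

theorem map_spaceS (hT : IsPositiveStarMap T) {x : Bidual A} (hx : x ∈ spaceS A) :
    bidualMap T x ∈ spaceS B := by
  refine map_mem_closure (bidualMap T).continuous hx fun y hy => ?_
  have h : Submodule.span ℝ (stronglyLSC A) ≤ (Submodule.span ℝ (stronglyLSC B)).comap
      ((bidualMap T).restrictScalars ℝ : Bidual A →ₗ[ℝ] Bidual B) :=
    Submodule.span_le.mpr fun z hz => Submodule.subset_span (hT.map_stronglyLSC hz)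
  exact h hy

theorem map_spaceU (hT : IsPositiveStarMap T) {x : Bidual A} (hx : x ∈ spaceU A) :
    bidualMap T x ∈ spaceU B :=
  mem_spaceU_iff.mpr ((hT.map_isSandwiched (mem_spaceU_iff.mp hx)).mono le_top)

theorem map_spaceUb (hT : IsPositiveStarMap T) {x : Bidual A} (hx : x ∈ spaceUb A) :
    bidualMap T x ∈ spaceUb B := by
  obtain ⟨C, hC, hx⟩ := mem_spaceUb_iff.mp hx
  exact mem_spaceUb_iff.mpr ⟨_, ENNReal.mul_ne_top enorm_ne_top hC, hT.map_isSandwiched hx⟩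

theorem map_spaceUbBar (hT : IsPositiveStarMap T) {x : Bidual A} (hx : x ∈ spaceUbBar A) :
    bidualMap T x ∈ spaceUbBar B :=
  map_mem_closure (bidualMap T).continuous hx fun _ => hT.map_spaceUb

theorem map_spaceU0 (hT : IsPositiveStarMap T) {x : Bidual A} (hx : x ∈ spaceU0 A) :
    bidualMap T x ∈ spaceU0 B := by
  have hbd : ∀ a : ℕ → Bidual A, (∃ C : ℝ, ∀ k, ‖a k‖ ≤ C) →
      ∃ C : ℝ, ∀ k, ‖bidualMap T (a k)‖ ≤ C := by
    rintro a ⟨C, hC⟩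
    exact ⟨‖T‖ * C, fun k => (norm_bidualMap_le T (a k)).trans
      (mul_le_mul_of_nonneg_left (hC k) (norm_nonneg T))⟩
  change MonoSeqClosure (spaceUb A) x at hx
  change MonoSeqClosure (spaceUb B) _
  induction hx with
  | base x hx => exact .base _ (hT.map_spaceUb hx)
  | incr a x _ hm hb hl ih =>
    exact .incr (fun k => bidualMap T (a k)) _ ih (fun k => hT.map_le (hm k)) (hbd a hb)
      (fun φ => hl (φ.comp T))
  | decr a x _ hm hb hl ih =>
    exact .decr (fun k => bidualMap T (a k)) _ ih (fun k => hT.map_le (hm k)) (hbd a hb)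
      (fun φ => hl (φ.comp T))

end IsPositiveStarMap

end PositiveMaps

/-! ### Positive maps between an algebra and its matrix algebra -/

section Matrices

variable {A : Type u} [NonUnitalCStarAlgebra A] [PartialOrder A] [StarOrderedRing A] {n : ℕ}

/-- The positive map `a ↦ (conj v_i v_j a)` from `A` to `M_n(A)`. -/
def inflate (v : Fin n → ℂ) : A →L[ℂ] CStarMatrix (Fin n) (Fin n) A :=
  ∑ p : Fin n × Fin n, (star (v p.1) * v p.2) • singleL p.1 p.2

/-- The positive map `(a_ij) ↦ ∑ conj v_i v_j a_ij` from `M_n(A)` to `A`. -/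
def compress (v : Fin n → ℂ) : CStarMatrix (Fin n) (Fin n) A →L[ℂ] A :=
  ∑ p : Fin n × Fin n, (star (v p.1) * v p.2) • entryL p.1 p.2

theorem inflate_apply (v : Fin n → ℂ) (a : A) (i j : Fin n) :
    inflate v a i j = (star (v i) * v j) • a := by
  change entryL i j (inflate v a) = _
  rw [inflate, sum_apply, map_sum, Finset.sum_eq_single (i, j)]
  · change (star (v i) * v j) • singleL i j a i j = _
    rw [singleL_apply, if_pos ⟨rfl, rfl⟩]
  · rintro ⟨k, l⟩ - hne
    change (star (v k) * v l) • singleL k l a i j = _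
    rw [singleL_apply, if_neg (fun h => hne (Prod.ext h.1 h.2)), smul_zero]
  · simp

omit [PartialOrder A] [StarOrderedRing A] in
theorem compress_apply (v : Fin n → ℂ) (a : CStarMatrix (Fin n) (Fin n) A) :
    compress v a = ∑ i, ∑ j, (star (v i) * v j) • a i j := by
  rw [compress, sum_apply, Fintype.sum_prod_type]
  rfl

theorem isPositiveStarMap_inflate (v : Fin n → ℂ) :
    IsPositiveStarMap (inflate v : A →L[ℂ] CStarMatrix (Fin n) (Fin n) A) where
  map_star a := by
    ext i j
    rw [CStarMatrix.star_apply, inflate_apply, inflate_apply, star_smul, star_mul, star_star]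
  comp φ hφ a := by
    rw [ContinuousLinearMap.comp_apply]
    rcases isEmpty_or_nonempty (Fin n) with _ | ⟨⟨o⟩⟩
    · have h : inflate v (star a * a) = 0 := by
        ext i
        exact isEmptyElim i
      simp [h]
    · -- `a ↦ v* (a* a) v = b* b`, where `b` has `a v` in row `o` and zeros elsewhere.
      have h : inflate v (star a * a) =
          star (CStarMatrix.ofMatrix (Matrix.of fun i j => if i = o then v j • a else 0)) *
            CStarMatrix.ofMatrix (Matrix.of fun i j => if i = o then v j • a else 0) := by
        ext i j
        rw [inflate_apply, CStarMatrix.mul_apply, Finset.sum_eq_single o]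
        · simp [CStarMatrix.star_apply, smul_mul_smul_comm]
        · intro k _ hk
          simp [CStarMatrix.star_apply, hk]
        · simp
      rw [h]
      exact hφ _

/-- A product `b* b` is sent to `∑ₖ cₖ* cₖ`, where `cₖ = ∑ᵢ v_i b_ki`. -/
theorem isPositiveStarMap_compress (v : Fin n → ℂ) :
    IsPositiveStarMap (compress v : CStarMatrix (Fin n) (Fin n) A →L[ℂ] A) where
  map_star a := by
    simp only [compress_apply, CStarMatrix.star_apply, star_sum, star_smul, star_mul, star_star]
    exact Finset.sum_comm
  comp φ hφ a := by
    have h : compress v (star a * a) =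
        ∑ k, star (∑ i, v i • a k i) * ∑ j, v j • a k j := by
      simp only [compress_apply, CStarMatrix.mul_apply, CStarMatrix.star_apply, star_sum,
        star_smul, Finset.sum_mul_sum, smul_mul_smul_comm, Finset.smul_sum]
      rw [Finset.sum_comm_cycle]
    rw [ContinuousLinearMap.comp_apply, h, map_sum, Complex.re_sum, Complex.im_sum]
    exact ⟨Finset.sum_nonneg fun k _ => (hφ _).1, Finset.sum_eq_zero fun k _ => (hφ _).2⟩

/-! ### Polarization -/

/-- The vectors `e_i + I ^ k e_j`, whose rank-one matrices `v* v` polarize the matrix unit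
`e_ij`. -/
def polarVector (i j : Fin n) (k : Fin 4) : Fin n → ℂ :=
  Pi.single i 1 + Pi.single j (Complex.I ^ (k : ℕ))

/-- The polarization identity `e_ij = ¼ ∑ₖ conj (I ^ k) v_k* v_k`, entry by entry. -/
theorem sum_polarVector (i j p q : Fin n) :
    ∑ k : Fin 4, (4⁻¹ * (-Complex.I) ^ (k : ℕ)) *
      (star (polarVector i j k p) * polarVector i j k q) = if i = p ∧ j = q then 1 else 0 := by
  have h : ∀ s t s' t' : ℂ, star s = s → star t = t →
      ∑ k : Fin 4, (4⁻¹ * (-Complex.I) ^ (k : ℕ)) *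
        (star (s + t * Complex.I ^ (k : ℕ)) * (s' + t' * Complex.I ^ (k : ℕ))) = s * t' := by
    intro s t s' t' hs ht
    simp only [star_add, star_mul, star_pow, hs, ht, Complex.star_def, Complex.conj_I,
      Fin.sum_univ_four, Fin.coe_ofNat_eq_mod]
    ring_nf
    simp only [Complex.I_sq, Complex.I_pow_three, Complex.I_pow_four,
      show Complex.I ^ 6 = -1 by
        rw [pow_add Complex.I 4 2, Complex.I_pow_four, Complex.I_sq, one_mul],
      show Complex.I ^ 9 = Complex.I by
        rw [show 9 = 4 + 4 + 1 from rfl, pow_succ, pow_add, Complex.I_pow_four, one_mul, one_mul]]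
    ring
  have hv : ∀ k r, polarVector i j k r =
      (if i = r then 1 else 0) + (if j = r then 1 else 0) * Complex.I ^ (k : ℕ) := by
    intro k r
    simp only [polarVector, Pi.add_apply, Pi.single_apply, eq_comm (a := r), ite_mul, one_mul,
      zero_mul]
  simp only [hv]
  rw [h _ _ _ _ (by split_ifs <;> simp) (by split_ifs <;> simp), ite_and]
  split_ifs <;> simp

theorem singleL_eq_sum_inflate (i j : Fin n) :
    (singleL i j : A →L[ℂ] CStarMatrix (Fin n) (Fin n) A) =
      ∑ k : Fin 4, (4⁻¹ * (-Complex.I) ^ (k : ℕ)) • inflate (polarVector i j k) := by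
  simp only [inflate, Finset.smul_sum, smul_smul]
  rw [Finset.sum_comm]
  simp only [← Finset.sum_smul, sum_polarVector]
  rw [Finset.sum_eq_single (i, j)]
  · simp
  · rintro ⟨p, q⟩ - hne
    rw [if_neg (fun h => hne (Prod.ext h.1.symm h.2.symm)), zero_smul]
  · simp

omit [PartialOrder A] [StarOrderedRing A] in
theorem entryL_eq_sum_compress (i j : Fin n) :
    (entryL i j : CStarMatrix (Fin n) (Fin n) A →L[ℂ] A) =
      ∑ k : Fin 4, (4⁻¹ * (-Complex.I) ^ (k : ℕ)) • compress (polarVector i j k) := by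
  simp only [compress, Finset.smul_sum, smul_smul]
  rw [Finset.sum_comm]
  simp only [← Finset.sum_smul, sum_polarVector]
  rw [Finset.sum_eq_single (i, j)]
  · simp
  · rintro ⟨p, q⟩ - hne
    rw [if_neg (fun h => hne (Prod.ext h.1.symm h.2.symm)), zero_smul]
  · simp

theorem matrixBidual_eq_sum (x : Matrix (Fin n) (Fin n) (Bidual A)) :
    matrixBidual x = ∑ i, ∑ j, bidualMap (singleL i j) (x i j) := rfl

theorem bidualMap_entryL_matrixBidual (x : Matrix (Fin n) (Fin n) (Bidual A)) (i j : Fin n) :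
    bidualMap (entryL i j) (matrixBidual x) = x i j :=
  congrFun (congrFun (matrixBidual.symm_apply_apply x) i) j

/-- Membership in a complexified subspace is decided entrywise whenever the real subspaces are
respected by the biduals of positive maps in both directions. -/
theorem matrixBidual_mem_complexify_iff (X : Submodule ℝ (Bidual A))
    (Y : Submodule ℝ (Bidual (CStarMatrix (Fin n) (Fin n) A)))
    (hXY : ∀ T : A →L[ℂ] CStarMatrix (Fin n) (Fin n) A, IsPositiveStarMap T →
      ∀ y ∈ X, bidualMap T y ∈ Y)
    (hYX : ∀ T : CStarMatrix (Fin n) (Fin n) A →L[ℂ] A, IsPositiveStarMap T →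
      ∀ y ∈ Y, bidualMap T y ∈ X)
    (x : Matrix (Fin n) (Fin n) (Bidual A)) :
    matrixBidual x ∈ complexify (Y : Set (Bidual (CStarMatrix (Fin n) (Fin n) A))) ↔
      ∀ i j, x i j ∈ complexify (X : Set (Bidual A)) := by
  simp only [← mem_complexifySubmodule]
  constructor
  · intro h i j
    rw [← bidualMap_entryL_matrixBidual x i j, entryL_eq_sum_compress, bidualMap_sum_smul]
    exact Submodule.sum_mem _ fun k _ => Submodule.smul_mem _ _ <|
      bidualMap_mem_complexify (hYX _ (isPositiveStarMap_compress _)) h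
  · intro h
    rw [matrixBidual_eq_sum]
    refine Submodule.sum_mem _ fun i _ => Submodule.sum_mem _ fun j _ => ?_
    rw [singleL_eq_sum_inflate, bidualMap_sum_smul]
    exact Submodule.sum_mem _ fun k _ => Submodule.smul_mem _ _ <|
      bidualMap_mem_complexify (hXY _ (isPositiveStarMap_inflate _)) (h i j)

end Matrices

end UnivMeas

end

theorem proposition3 {A : Type u} [NonUnitalCStarAlgebra A] [PartialOrder A] [StarOrderedRing A]
    (n : ℕ) (x : Matrix (Fin n) (Fin n) (UnivMeas.Bidual A)) :
    (UnivMeas.matrixBidual x ∈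
        UnivMeas.complexify (UnivMeas.spaceS (CStarMatrix (Fin n) (Fin n) A)) ↔
      ∀ i j, x i j ∈ UnivMeas.complexify (UnivMeas.spaceS A)) ∧
    (UnivMeas.matrixBidual x ∈
        UnivMeas.complexify (UnivMeas.spaceUb (CStarMatrix (Fin n) (Fin n) A)) ↔
      ∀ i j, x i j ∈ UnivMeas.complexify (UnivMeas.spaceUb A)) ∧
    (UnivMeas.matrixBidual x ∈
        UnivMeas.complexify (UnivMeas.spaceUbBar (CStarMatrix (Fin n) (Fin n) A)) ↔
      ∀ i j, x i j ∈ UnivMeas.complexify (UnivMeas.spaceUbBar A)) ∧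
    (UnivMeas.matrixBidual x ∈
        UnivMeas.complexify (UnivMeas.spaceU0 (CStarMatrix (Fin n) (Fin n) A)) ↔
      ∀ i j, x i j ∈ UnivMeas.complexify (UnivMeas.spaceU0 A)) ∧
    (UnivMeas.matrixBidual x ∈
        UnivMeas.complexify (UnivMeas.spaceU (CStarMatrix (Fin n) (Fin n) A)) ↔
      ∀ i j, x i j ∈ UnivMeas.complexify (UnivMeas.spaceU A)) := by
  refine ⟨?_, ?_, ?_, ?_, ?_⟩
  · exact UnivMeas.matrixBidual_mem_complexify_iff (UnivMeas.submoduleS A)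
      (UnivMeas.submoduleS _) (fun _ hT _ => hT.map_spaceS) (fun _ hT _ => hT.map_spaceS) x
  · exact UnivMeas.matrixBidual_mem_complexify_iff (UnivMeas.submoduleUb A)
      (UnivMeas.submoduleUb _) (fun _ hT _ => hT.map_spaceUb) (fun _ hT _ => hT.map_spaceUb) x
  · exact UnivMeas.matrixBidual_mem_complexify_iff (UnivMeas.submoduleUbBar A)
      (UnivMeas.submoduleUbBar _) (fun _ hT _ => hT.map_spaceUbBar)
      (fun _ hT _ => hT.map_spaceUbBar) x
  · exact UnivMeas.matrixBidual_mem_complexify_iff (UnivMeas.submoduleU0 A)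
      (UnivMeas.submoduleU0 _) (fun _ hT _ => hT.map_spaceU0) (fun _ hT _ => hT.map_spaceU0) x
  · exact UnivMeas.matrixBidual_mem_complexify_iff (UnivMeas.submoduleU A)
      (UnivMeas.submoduleU _) (fun _ hT _ => hT.map_spaceU) (fun _ hT _ => hT.map_spaceU) x
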